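/- **Setting.** Let $\Delta>0$, $\mathcal C:=C([-\Delta,0],\mathbb R^n)$ with $\|\phi\|=\sup_\theta|\phi(\theta)|$ ($|\cdot|$ the Euclidean norm), and consider $$\dot x(t)=f(x_t)+g(x_t)u,\quad t>0,\qquad x(\theta)=\xi(\theta),\ \theta\in[-\Delta,0],\qquad x_t(\theta)=x(t+\theta),$$ where $f:\mathcal C\to\mathbb R^n$ and $g:\mathcal C\to\mathbb R^{n\times m}$ are locally Lipschitz, $f(0)=0$, and $U\subseteq\mathbb R^m$ is the set of input values. Class $\mathcal K$: continuous, strictly increasing $\alpha:[0,\infty)\to[0,\infty)$ with $\alpha(0)=0$; class $\mathcal K_\infty$: in addition unbounded; class $\mathcal{KL}$: $\beta(\cdot,t)\in\mathcal K$ for each $t\ge0$, and $\beta(s,\cdot)$ nonincreasing with limit $0$ at $\infty$ for each $s\ge0$. **Functionals.** Let $V(\phi)=V_1(\phi(0))+V_2(\phi)$. It is *smoothly separable* if $V_1:\mathbb R^n\to[0,\infty)$ is $C^1$, $V_2:\mathcal C\to[0,\infty)$ is locally Lipschitz, and $\alpha_1(|x|)\le V_1(x)\le\alpha_2(|x|)$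 for all $x$, for some $\alpha_1,\alpha_2\in\mathcal K_\infty$. It is *continuously i-differentiable* if for every $\phi\in\mathcal C$ the upper Dini derivative $D^+V_2(\phi)=\limsup_{v\to0^+}\frac{V_2(y_v)-V_2(\phi)}{v}$ is finite and the same for all continuous extensions $y$ of $\phi$ to the right of $0$, if for all $x\in\mathbb R^n$ and all such $\phi,y$ $$V_1(x+z)+V_2(y_l)-V_1(x)-V_2(\phi)=V_1'(x)z+D^+V_2(\phi)\,l+o\big(\sqrt{|z|^2+l^2}\big)\quad\text{as }(z,l)\to0,\ l\ge0,$$ and if $\phi\mapsto D^+V_2(\phi)$ is continuous on $\mathcal C$. Write $L_fV_1(\phi)=V_1'(\phi(0))f(\phi)$ and $L_gV_1(\phi)=V_1'(\phi(0))g(\phi)$. A smoothly separable, continuously i-differentiable $V$ is a *control Lyapunov–Krasovskii functional* with rate $\gamma\in\mathcal K$ if there are $\alpha_{1},\alpha_{2}\in\mathcal K_\infty$ with $\alpha_{1}(|\phi(0)|)\le V(\phi)\le\alpha_{2}(\|\phi\|)$ for all $\phi$, and $$\inf_{u\in U}\{L_fV_1(\phi)+D^+V_2(\phi)+L_gV_1(\phi)u\}<-\gamma(V(\phi))\quad\text{for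 all }\phi\ne0.$$ The *Krasovskii-type small control property* holds if for every $\varepsilon>0$ there is $\delta>0$ such that for every $\phi\neq0$ with $|\phi(\theta)|<\delta$ for all $\theta$ there is $u\in\mathbb R^m$, $|u|<\varepsilon$, with $L_fV_1(\phi)+D^+V_2(\phi)+L_gV_1(\phi)u<-\gamma(V(\phi))$. **Theorem.** Suppose the system has a control Lyapunov–Krasovskii functional $V$ with rate $\gamma$ and satisfies the Krasovskii-type small control property. Let $\lambda>0$, $a(\phi)=L_fV_1(\phi)+D^+V_2(\phi)+\gamma(V(\phi))$, $$\kappa(\lambda,p,q)=-\frac{p+\sqrt{p^2+\lambda|q|^4}}{|q|^2}\,q\ \ (q\ne0),\qquad\kappa(\lambda,p,0)=0,$$ and $u(\phi)=\kappa(\lambda,a(\phi),(L_gV_1(\phi))^\top)$ for $\phi\neq0$, $u(0)=0$. Then: 1. $u:\mathcal C\to\mathbb R^m$ is continuous. 2. The closed-loop system $\dot x(t)=f(x_t)+g(x_t)u(x_t)$ has a solution on some $[-\Delta,T)$, $T>0$, from every initial history $\xi\in\mathcal C$. 3. The closed-loop system is globally asymptotically stable: there is $\beta\in\mathcal{KL}$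 such that every solution $x$ (on any interval $[-\Delta,T)$, $0<T\le\infty$), from any $\xi\in\mathcal C$, satisfies $|x(t)|\le\beta(\|\xi\|,t)$ for all $t\ge0$ in its interval of definition. 4. If $\phi\mapsto f(\phi)+g(\phi)u(\phi)$ maps bounded sets to bounded sets, then every solution extends to a solution on $[-\Delta,\infty)$. -/

import Mathlib

open Set Filter Topology

noncomputable section

namespace DelayControl

/-- `ℝⁿ` with the Euclidean norm. -/
abbrev Vec (n : ℕ) : Type := EuclideanSpace ℝ (Fin n)

/-- `C([-Δ, 0], ℝⁿ)` with the supremum norm. -/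
abbrev Hist (Δ : ℝ) (n : ℕ) : Type := C(Icc (-Δ) (0 : ℝ), Vec n)

/-! ### Comparison functions -/

/-- Class `K` (a function on `[0, ∞)`; values at negative arguments are irrelevant). -/
structure ClassK (α : ℝ → ℝ) : Prop where
  continuousOn : ContinuousOn α (Ici 0)
  map_zero : α 0 = 0
  strictMonoOn : StrictMonoOn α (Ici 0)

/-- Class `K_∞`: class `K` and unbounded. -/
structure ClassKInf (α : ℝ → ℝ) : Prop extends ClassK α where
  unbounded : ∀ M : ℝ, ∃ s : ℝ, 0 ≤ s ∧ M < α s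

/-- Class `KL`. -/
structure ClassKL (β : ℝ → ℝ → ℝ) : Prop where
  classK : ∀ t : ℝ, 0 ≤ t → ClassK (fun s => β s t)
  antitoneOn : ∀ s : ℝ, 0 ≤ s → AntitoneOn (fun t => β s t) (Ici 0)
  tendsto_zero : ∀ s : ℝ, 0 ≤ s → Tendsto (fun t => β s t) atTop (𝓝 0)

/-! ### Histories and solutions of `x'(t) = F(x_t)` -/

section

variable {Δ : ℝ} {n m : ℕ}

/-- `φ(0)`. -/
def now [hΔ : Fact (0 < Δ)] (φ : Hist Δ n) : Vec n :=
  φ ⟨0, by have := hΔ.out; constructor <;> linarith⟩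

open Classical in
/-- The segment `x_t(θ) = x(t + θ)`, `θ ∈ [-Δ, 0]`. The default value `0` is only taken when this
segment is not continuous. -/
def seg (Δ : ℝ) {n : ℕ} (x : ℝ → Vec n) (t : ℝ) : Hist Δ n :=
  if h : Continuous (fun θ : Icc (-Δ) (0 : ℝ) => x (t + θ)) then ⟨_, h⟩ else 0

/-- `x` is a solution on `[-Δ, T)` of `x'(t) = F(x_t)`, `0 < t < T`, with initial history `ξ`. -/
structure IsSolutionOn (F : Hist Δ n → Vec n) (ξ : Hist Δ n) (T : ℝ) (x : ℝ → Vec n) : Prop where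
  continuousOn : ContinuousOn x (Ico (-Δ) T)
  initial : ∀ θ : Icc (-Δ) (0 : ℝ), x θ = ξ θ
  hasDerivAt : ∀ t ∈ Ioo 0 T, HasDerivAt x (F (seg Δ x t)) t

/-- `x` is a solution on `[-Δ, ∞)`. -/
def IsGlobalSolution (F : Hist Δ n → Vec n) (ξ : Hist Δ n) (x : ℝ → Vec n) : Prop :=
  ∀ T : ℝ, 0 < T → IsSolutionOn F ξ T x

/-- Global asymptotic stability of `x'(t) = F(x_t)`: one `KL` function bounds all solutions, at all
times `t ≥ 0` at which they are defined (the solutions need be neither unique nor global). -/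
def IsGAS (F : Hist Δ n → Vec n) : Prop :=
  ∃ β : ℝ → ℝ → ℝ, ClassKL β ∧
    ∀ (ξ : Hist Δ n) (T : ℝ) (x : ℝ → Vec n), 0 < T → IsSolutionOn F ξ T x →
      ∀ t ∈ Ico 0 T, ‖x t‖ ≤ β ‖ξ‖ t

/-- `F` maps bounded sets to bounded sets. -/
def MapsBoundedToBounded (F : Hist Δ n → Vec n) : Prop :=
  ∀ R : ℝ, ∃ K : ℝ, ∀ φ : Hist Δ n, ‖φ‖ ≤ R → ‖F φ‖ ≤ K

/-! ### Derivatives of functionals -/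

/-- `y` is a continuous extension of the history `φ` beyond time `0`
(only its values near `0` to the right matter). -/
structure IsExtension (φ : Hist Δ n) (y : ℝ → Vec n) : Prop where
  continuous : Continuous y
  eq_hist : ∀ θ : Icc (-Δ) (0 : ℝ), y θ = φ θ

/-- The upper Dini derivative `limsup_{v → 0⁺} (W(y_v) - W(y_0)) / v` of the functional `W`
along `y`, as an extended real. -/
def diniAlong (W : Hist Δ n → ℝ) (y : ℝ → Vec n) : EReal :=
  limsup (fun v : ℝ => (((W (seg Δ y v) - W (seg Δ y 0)) / v : ℝ) : EReal)) (𝓝[>] 0)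

/-- `D⁺W(φ)`, computed along the extension of `φ` by the constant `φ(0)`. For the functionals below
it is the same along every continuous extension. -/
def dini [hΔ : Fact (0 < Δ)] (W : Hist Δ n → ℝ) (φ : Hist Δ n) : ℝ :=
  (diniAlong W (IccExtend (by have := hΔ.out; linarith : -Δ ≤ (0 : ℝ)) φ)).toReal

/-- The functional `V(φ) = V₁(φ(0)) + V₂(φ)`. -/
def sepFunctional [Fact (0 < Δ)] (V₁ : Vec n → ℝ) (V₂ : Hist Δ n → ℝ) (φ : Hist Δ n) : ℝ :=
  V₁ (now φ) + V₂ φ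

/-- `φ ↦ V₁(φ(0)) + V₂(φ)` is smoothly separable. -/
structure IsSmoothlySeparable (V₁ : Vec n → ℝ) (V₂ : Hist Δ n → ℝ) : Prop where
  contDiff : ContDiff ℝ 1 V₁
  nonneg₁ : ∀ x, 0 ≤ V₁ x
  locallyLipschitz : LocallyLipschitz V₂
  nonneg₂ : ∀ φ, 0 ≤ V₂ φ
  bounds : ∃ α₁ α₂ : ℝ → ℝ, ClassKInf α₁ ∧ ClassKInf α₂ ∧
    ∀ x : Vec n, α₁ ‖x‖ ≤ V₁ x ∧ V₁ x ≤ α₂ ‖x‖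

/-- `φ ↦ V₁(φ(0)) + V₂(φ)` is continuously invariantly differentiable. -/
structure IsContIDifferentiable [Fact (0 < Δ)] (V₁ : Vec n → ℝ) (V₂ : Hist Δ n → ℝ) : Prop where
  differentiable : Differentiable ℝ V₁
  /-- `D⁺V₂(φ)` exists (is finite) and does not depend on the extension of `φ`. -/
  invariant : ∀ (φ : Hist Δ n) (y : ℝ → Vec n), IsExtension φ y →
    diniAlong V₂ y = (dini V₂ φ : EReal)
  /-- First-order expansion: as `(z, l) → 0` with `l ≥ 0`,
  `V(x + z, y_l) - V(x, y_0) = V₁'(x) z + D⁺V₂(φ) l + o(√(|z|² + l²))`,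
  where `V(x, φ) = V₁(x) + V₂(φ)` and `y` extends `φ = y_0`. -/
  expansion : ∀ (x : Vec n) (φ : Hist Δ n) (y : ℝ → Vec n), IsExtension φ y →
    (fun p : Vec n × ℝ => (V₁ (x + p.1) + V₂ (seg Δ y p.2)) - (V₁ x + V₂ φ)
        - (fderiv ℝ V₁ x p.1 + dini V₂ φ * p.2))
      =o[𝓝[{p : Vec n × ℝ | 0 ≤ p.2}] 0] (fun p : Vec n × ℝ => √(‖p.1‖ ^ 2 + p.2 ^ 2))
  continuous_dini : Continuous (dini V₂)

/-- `L_f V₁(φ) = V₁'(φ(0)) f(φ)`. -/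
def lieF [Fact (0 < Δ)] (f : Hist Δ n → Vec n) (V₁ : Vec n → ℝ) (φ : Hist Δ n) : ℝ :=
  fderiv ℝ V₁ (now φ) (f φ)

/-- The row vector `L_g V₁(φ) = V₁'(φ(0)) g(φ)`, as a linear form on `ℝᵐ`. -/
def lieG [Fact (0 < Δ)] (g : Hist Δ n → Vec m →L[ℝ] Vec n) (V₁ : Vec n → ℝ) (φ : Hist Δ n) :
    Vec m →L[ℝ] ℝ :=
  (fderiv ℝ V₁ (now φ)).comp (g φ)

/-- The column vector `(L_g V₁(φ))ᵀ ∈ ℝᵐ`. -/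
def lieGT [Fact (0 < Δ)] (g : Hist Δ n → Vec m →L[ℝ] Vec n) (V₁ : Vec n → ℝ) (φ : Hist Δ n) :
    Vec m :=
  (InnerProductSpace.toDual ℝ (Vec m)).symm (lieG g V₁ φ)

/-! ### Control Lyapunov–Krasovskii functionals and the small control property -/

/-- `V(φ) = V₁(φ(0)) + V₂(φ)` is a control Lyapunov–Krasovskii functional, with decay rate `γ`, for
`x' = f(x_t) + g(x_t) u`, `u ∈ U`. The infimum is taken in the extended reals. -/
structure IsCLKF [Fact (0 < Δ)] (f : Hist Δ n → Vec n) (g : Hist Δ n → Vec m →L[ℝ] Vec n)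
    (U : Set (Vec m)) (V₁ : Vec n → ℝ) (V₂ : Hist Δ n → ℝ) (γ : ℝ → ℝ) : Prop where
  separable : IsSmoothlySeparable V₁ V₂
  iDifferentiable : IsContIDifferentiable V₁ V₂
  bounds : ∃ α₁ α₂ : ℝ → ℝ, ClassKInf α₁ ∧ ClassKInf α₂ ∧
    ∀ φ : Hist Δ n, α₁ ‖now φ‖ ≤ sepFunctional V₁ V₂ φ ∧ sepFunctional V₁ V₂ φ ≤ α₂ ‖φ‖
  classK : ClassK γ
  decrease : ∀ φ : Hist Δ n, φ ≠ 0 →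
    (⨅ u ∈ U, ((lieF f V₁ φ + dini V₂ φ + lieG g V₁ φ u : ℝ) : EReal))
      < ((-γ (sepFunctional V₁ V₂ φ) : ℝ) : EReal)

/-- The Krasovskii-type small control property. -/
def KrasovskiiSCP [Fact (0 < Δ)] (f : Hist Δ n → Vec n) (g : Hist Δ n → Vec m →L[ℝ] Vec n)
    (V₁ : Vec n → ℝ) (V₂ : Hist Δ n → ℝ) (γ : ℝ → ℝ) : Prop :=
  ∀ ε : ℝ, 0 < ε → ∃ δ : ℝ, 0 < δ ∧ ∀ φ : Hist Δ n, φ ≠ 0 → (∀ θ, ‖φ θ‖ < δ) →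
    ∃ u : Vec m, ‖u‖ < ε ∧
      lieF f V₁ φ + dini V₂ φ + lieG g V₁ φ u < -γ (sepFunctional V₁ V₂ φ)

/-! ### The controller -/

open Classical in
/-- Sontag's formula. -/
def kappa (lam p : ℝ) (q : Vec m) : Vec m :=
  if q = 0 then 0 else ((p + √(p ^ 2 + lam * ‖q‖ ^ 4)) / (-‖q‖ ^ 2)) • q

/-- `a(φ) = L_f V₁(φ) + D⁺V₂(φ) + γ(V(φ))`. -/
def aFun [Fact (0 < Δ)] (f : Hist Δ n → Vec n) (V₁ : Vec n → ℝ) (V₂ : Hist Δ n → ℝ) (γ : ℝ → ℝ)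
    (φ : Hist Δ n) : ℝ :=
  lieF f V₁ φ + dini V₂ φ + γ (sepFunctional V₁ V₂ φ)

open Classical in
/-- The feedback `u(φ) = κ(λ, a(φ), (L_g V₁(φ))ᵀ)` for `φ ≠ 0`, `u(0) = 0`. -/
def controller [Fact (0 < Δ)] (f : Hist Δ n → Vec n) (g : Hist Δ n → Vec m →L[ℝ] Vec n)
    (V₁ : Vec n → ℝ) (V₂ : Hist Δ n → ℝ) (γ : ℝ → ℝ) (lam : ℝ) (φ : Hist Δ n) : Vec m :=
  if φ = 0 then 0 else kappa lam (aFun f V₁ V₂ γ φ) (lieGT g V₁ φ)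

/-- The closed-loop right-hand side `f(φ) + g(φ) u(φ)`. -/
def closedLoop (f : Hist Δ n → Vec n) (g : Hist Δ n → Vec m →L[ℝ] Vec n)
    (u : Hist Δ n → Vec m) (φ : Hist Δ n) : Vec n :=
  f φ + g φ (u φ)

end

end DelayControl

end

open DelayControl

/-!
The proof combines a Lyapunov argument with an existence theorem of Peano type.

*The feedback.* Write `q(φ) = (L_g V₁(φ))ᵀ` and let `a(φ)` be the drift term `aFun`. Sontag's formula
is continuous at `(p, q)` unless `q = 0` and `p ≥ 0` (`continuousAt_kappa`), and the decrease
condition excludes that case for `φ ≠ 0` (`IsCLKF.aFun_neg`). At `φ = 0` the small control property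
gives `a(φ) ≤ ε |q(φ)|`, whence `|u(φ)| ≤ 2 ε + √λ |q(φ)|` (`norm_kappa_le`), and `q(φ) → 0` because
`V₁` is minimal at the origin.

*Existence.* For a bounded continuous right-hand side, Tonelli's retarded integral operator has
fixed points on long intervals; they are equicontinuous, and a limit point in the compact-open
topology solves the equation for all times (`exists_global_solution_of_bounded`). A radial
truncation reduces local existence to that case.

*Stability.* Along a solution, `W(t) = V(x_t)` has a right derivative, which is
`a - γ(V) + ⟪q, u⟫ ≤ -γ(W)` (`IsContIDifferentiable.hasDerivWithinAt_sepFunctional`,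
`IsCLKF.decay_closedLoop`). Instead of solving the comparison equation `w' = -γ(w)`, observe that if
`W(t) > c` then `W > c` on all of `[0, t]`, so `W` has lost at least `t γ(c)`. Hence `W(t) ≤ c` as
soon as `c + t γ(c) ≥ W(0)` (`le_of_decay`), and solving `α₁(r) + t γ(α₁(r)) = α₂(s)` for `r` gives
the `KL` function `β(s, t) = r` directly (`exists_classKL`).

*Continuation.* A solution on a finite interval is bounded by stability, so its velocity is bounded
and it extends continuously to the right end point. It is continued by a global solution of the
equation truncated far out; by stability this solution never enters the region where the truncation
is active (`IsGAS.exists_isGlobalSolution`).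
-/

namespace DelayControl

/-! ### Segments of continuous functions -/

section Segments

variable {Δ : ℝ} {n : ℕ}

/-- The segment map for globally continuous functions, as a continuous function of the pair
`(x, t)`; it agrees with `seg`. -/
def segC (Δ : ℝ) {n : ℕ} (x : C(ℝ, Vec n)) (t : ℝ) : Hist Δ n :=
  x.comp ⟨fun θ : Icc (-Δ) (0 : ℝ) => t + θ, by fun_prop⟩

lemma seg_eq_segC (x : C(ℝ, Vec n)) (t : ℝ) : seg Δ x t = segC Δ x t := by
  have h : Continuous (fun θ : Icc (-Δ) (0 : ℝ) => x (t + θ)) := by fun_prop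
  rw [seg, dif_pos h]
  rfl

lemma seg_apply_of_continuous {x : ℝ → Vec n} (hx : Continuous x) (t : ℝ)
    (θ : Icc (-Δ) (0 : ℝ)) : seg Δ x t θ = x (t + θ) := by
  have h : Continuous (fun θ : Icc (-Δ) (0 : ℝ) => x (t + θ)) := by fun_prop
  rw [seg, dif_pos h]
  rfl

lemma continuous_segC : Continuous fun p : C(ℝ, Vec n) × ℝ => segC Δ p.1 p.2 := by
  have h : Continuous fun t : ℝ =>
      (⟨fun θ : Icc (-Δ) (0 : ℝ) => t + θ, by fun_prop⟩ : C(Icc (-Δ) (0 : ℝ), ℝ)) :=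
    ContinuousMap.continuous_of_continuous_uncurry _ (by
      simp only [Function.uncurry_def, ContinuousMap.coe_mk]; fun_prop)
  exact ContinuousMap.continuous_comp'.comp ((h.comp continuous_snd).prodMk continuous_fst)

lemma continuous_seg {x : ℝ → Vec n} (hx : Continuous x) : Continuous (seg Δ x) := by
  have h : seg Δ x = fun t => segC Δ ⟨x, hx⟩ t := funext fun t => seg_eq_segC ⟨x, hx⟩ t
  rw [h]
  exact continuous_segC.comp (continuous_const.prodMk continuous_id)

lemma seg_eq_seg {x y : ℝ → Vec n} {t s : ℝ}
    (h : ∀ θ : Icc (-Δ) (0 : ℝ), x (t + θ) = y (s + θ)) : seg Δ x t = seg Δ y s := by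
  have h' : (fun θ : Icc (-Δ) (0 : ℝ) => x (t + θ)) = fun θ : Icc (-Δ) (0 : ℝ) => y (s + θ) :=
    funext h
  by_cases hc : Continuous fun θ : Icc (-Δ) (0 : ℝ) => x (t + θ)
  · rw [seg, seg, dif_pos hc, dif_pos (h' ▸ hc)]
    exact ContinuousMap.ext h
  · rw [seg, seg, dif_neg hc, dif_neg (h' ▸ hc)]

/-- A segment depends only on the values of the function on `[t - Δ, t]`. -/
lemma seg_congr {x y : ℝ → Vec n} {t : ℝ} (h : ∀ s ∈ Icc (t - Δ) t, x s = y s) :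
    seg Δ x t = seg Δ y t :=
  seg_eq_seg fun θ => h _ ⟨by linarith [θ.2.1], by linarith [θ.2.2]⟩

lemma seg_comp_add (x : ℝ → Vec n) (t s : ℝ) :
    seg Δ (fun v => x (t + v)) s = seg Δ x (t + s) :=
  seg_eq_seg fun θ => by rw [add_assoc]

lemma norm_seg_le {x : ℝ → Vec n} {t R : ℝ} (hR : 0 ≤ R)
    (h : ∀ s ∈ Icc (t - Δ) t, ‖x s‖ ≤ R) : ‖seg Δ x t‖ ≤ R := by
  by_cases hc : Continuous fun θ : Icc (-Δ) (0 : ℝ) => x (t + θ)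
  · rw [seg, dif_pos hc, ContinuousMap.norm_le _ hR]
    exact fun θ => h _ ⟨by linarith [θ.2.1], by linarith [θ.2.2]⟩
  · rw [seg, dif_neg hc, norm_zero]
    exact hR

end Segments

/-! ### Existence of solutions for bounded continuous right-hand sides -/

section Existence

variable {Δ : ℝ} {n : ℕ}

/-- Tonelli's retarded integral operator
`(Φ x)(t) = ξ(min t t₀) + ∫_{t₀}^{max (t - h) t₀} F(x_s) ds`. -/
noncomputable def tonelli (F : Hist Δ n → Vec n) (hF : Continuous F) (ξ : C(ℝ, Vec n)) (t₀ h : ℝ)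
    (x : C(ℝ, Vec n)) : C(ℝ, Vec n) where
  toFun t := ξ (min t t₀) + ∫ s in t₀..max (t - h) t₀, F (segC Δ x s)
  continuous_toFun := by
    have hc : Continuous fun s => F (segC Δ x s) :=
      hF.comp (continuous_segC.comp (continuous_const.prodMk continuous_id))
    have hp : Continuous fun b => ∫ s in t₀..b, F (segC Δ x s) :=
      intervalIntegral.continuous_primitive (fun a b => hc.intervalIntegrable a b) t₀
    exact (by fun_prop : Continuous fun t => ξ (min t t₀)).add
      (hp.comp (by fun_prop : Continuous fun t => max (t - h) t₀))

variable {F : Hist Δ n → Vec n} {hF : Continuous F} {ξ : C(ℝ, Vec n)} {t₀ h M : ℝ}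

lemma tonelli_apply (x : C(ℝ, Vec n)) (t : ℝ) : tonelli F hF ξ t₀ h x t =
    ξ (min t t₀) + ∫ s in t₀..max (t - h) t₀, F (segC Δ x s) := rfl

lemma segC_congr {x y : C(ℝ, Vec n)} {t : ℝ} (h : ∀ s ≤ t, x s = y s) :
    segC Δ x t = segC Δ y t := by
  rw [← seg_eq_segC, ← seg_eq_segC]
  exact seg_congr fun s hs => h s hs.2

/-- The retardation makes the iterates of the Tonelli operator stationary on ever longer
intervals. -/
lemma tonelli_iterate_eq (hh : 0 ≤ h) (j : ℕ) : ∀ t ≤ t₀ + j * h,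
    (tonelli F hF ξ t₀ h)^[j + 2] ξ t = (tonelli F hF ξ t₀ h)^[j + 1] ξ t := by
  induction j with
  | zero =>
    intro t ht
    have hm : max (t - h) t₀ = t₀ := max_eq_right (by simp at ht; linarith)
    simp only [Function.iterate_succ_apply', tonelli_apply, hm, intervalIntegral.integral_same]
  | succ j ih =>
    intro t ht
    push_cast at ht
    rw [Function.iterate_succ_apply', Function.iterate_succ_apply' _ (j + 1), tonelli_apply,
      tonelli_apply]
    congr 1
    refine intervalIntegral.integral_congr fun s hs => ?_
    rw [uIcc_of_le (le_max_right _ _)] at hs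
    have hs' : s ≤ t₀ + j * h := hs.2.trans (max_le (by linarith) (by
      have : 0 ≤ j * h := by positivity
      linarith))
    exact congrArg F (segC_congr fun r hr => by
      have := ih r (hr.trans hs')
      rwa [Function.iterate_succ_apply'] at this)

/-- The functions that start from `ξ t₀` and have a modulus of continuity shared by all values of the
Tonelli operators with `‖F‖ ≤ M`, whatever the retardation. -/
def tonelliRange (ξ : C(ℝ, Vec n)) (t₀ M : ℝ) : Set C(ℝ, Vec n) :=
  {x | x t₀ = ξ t₀ ∧ ∀ t s, dist (x t) (x s) ≤ M * |t - s| + dist (ξ (min t t₀)) (ξ (min s t₀))}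

lemma isCompact_tonelliRange (ξ : C(ℝ, Vec n)) (t₀ M : ℝ) :
    IsCompact (tonelliRange ξ t₀ M) := by
  apply ArzelaAscoli.isCompact_of_equicontinuous
  · have himg : ContinuousMap.toFun '' tonelliRange ξ t₀ M = {x : ℝ → Vec n | x t₀ = ξ t₀ ∧
        ∀ t s, dist (x t) (x s) ≤ M * |t - s| + dist (ξ (min t t₀)) (ξ (min s t₀))} := by
      ext x
      constructor
      · rintro ⟨y, hy, rfl⟩
        exact hy
      · intro hx
        have hc : Continuous x := by
          rw [continuous_iff_continuousAt]
          intro s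
          rw [ContinuousAt, tendsto_iff_dist_tendsto_zero]
          refine squeeze_zero (fun _ => dist_nonneg) (fun t => hx.2 t s) ?_
          have : Continuous fun t => M * |t - s| + dist (ξ (min t t₀)) (ξ (min s t₀)) := by
            fun_prop
          simpa using this.tendsto s
        exact ⟨⟨x, hc⟩, hx, rfl⟩
    rw [himg]
    refine IsCompact.of_isClosed_subset (isCompact_univ_pi fun t =>
      isCompact_closedBall (ξ t₀) (M * |t - t₀| + dist (ξ (min t t₀)) (ξ (min t₀ t₀)))) ?_ ?_
    · refine IsClosed.inter (isClosed_eq (continuous_apply t₀) continuous_const) ?_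
      have : {x : ℝ → Vec n | ∀ t s, dist (x t) (x s) ≤
          M * |t - s| + dist (ξ (min t t₀)) (ξ (min s t₀))} = ⋂ t, ⋂ s, {x : ℝ → Vec n |
          dist (x t) (x s) ≤ M * |t - s| + dist (ξ (min t t₀)) (ξ (min s t₀))} := by
        ext; simp
      change IsClosed {x : ℝ → Vec n | ∀ t s, dist (x t) (x s) ≤
          M * |t - s| + dist (ξ (min t t₀)) (ξ (min s t₀))}
      rw [this]
      exact isClosed_iInter fun t => isClosed_iInter fun s => isClosed_le
        ((continuous_apply t).dist (continuous_apply s)) continuous_const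
    · rintro x ⟨h0, hx⟩ t -
      rw [Metric.mem_closedBall, ← h0]
      exact hx t t₀
  · intro s
    refine Metric.equicontinuousAt_of_continuity_modulus
      (fun t => M * |s - t| + dist (ξ (min s t₀)) (ξ (min t t₀))) ?_ _ ?_
    · have : Continuous fun t => M * |s - t| + dist (ξ (min s t₀)) (ξ (min t t₀)) := by
        fun_prop
      simpa using this.tendsto s
    · exact Eventually.of_forall fun t x => x.2.2 s t

lemma tonelli_mem_range (hh : 0 ≤ h) (hM : ∀ φ, ‖F φ‖ ≤ M) (x : C(ℝ, Vec n)) :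
    tonelli F hF ξ t₀ h x ∈ tonelliRange ξ t₀ M := by
  have hc : Continuous fun s => F (segC Δ x s) :=
    hF.comp (continuous_segC.comp (continuous_const.prodMk continuous_id))
  have hM0 : 0 ≤ M := (norm_nonneg _).trans (hM 0)
  refine ⟨?_, fun t s => ?_⟩
  · have hm : max (t₀ - h) t₀ = t₀ := max_eq_right (by linarith)
    simp [tonelli_apply, hm]
  · rw [tonelli_apply, tonelli_apply, add_comm (M * _)]
    refine (dist_add_add_le _ _ _ _).trans (add_le_add le_rfl ?_)
    rw [dist_eq_norm, intervalIntegral.integral_interval_sub_left (hc.intervalIntegrable _ _)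
      (hc.intervalIntegrable _ _)]
    refine (intervalIntegral.norm_integral_le_of_norm_le_const fun r _ => hM _).trans ?_
    refine mul_le_mul_of_nonneg_left ?_ hM0
    refine (abs_max_sub_max_le_abs _ _ _).trans (le_of_eq ?_)
    congr 1
    ring

/-- **Peano's theorem** for delay equations with a bounded continuous right-hand side: the past
`ξ` on `(-∞, t₀]` is continued to all times by a solution of the integral equation. -/
theorem exists_global_solution_of_bounded (hF : Continuous F) (hM : ∀ φ, ‖F φ‖ ≤ M)
    {ξ : ℝ → Vec n} (hξ : Continuous ξ) (t₀ : ℝ) :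
    ∃ x : ℝ → Vec n, Continuous x ∧ (∀ t ≤ t₀, x t = ξ t) ∧
      ∀ t, t₀ ≤ t → x t = ξ t₀ + ∫ s in t₀..t, F (seg Δ x s) := by
  let Ξ : C(ℝ, Vec n) := ⟨ξ, hξ⟩
  let h : ℕ → ℝ := fun k => 1 / ((k : ℝ) + 1)
  have hh : ∀ k, 0 ≤ h k := fun k => by positivity
  have hM0 : 0 ≤ M := (norm_nonneg _).trans (hM 0)
  -- `(k + 1)²` steps of length `1 / (k + 1)` make the approximation exact up to time `t₀ + k + 1`.
  let X : ℕ → C(ℝ, Vec n) := fun k => (tonelli F hF Ξ t₀ (h k))^[(k + 1) ^ 2 + 1] Ξ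
  have hXmem : ∀ k, X k ∈ tonelliRange Ξ t₀ M := fun k => by
    simp only [X, Function.iterate_succ_apply']
    exact tonelli_mem_range (hh k) hM _
  have hXeq : ∀ k : ℕ, ∀ t ≤ t₀ + ((k : ℝ) + 1), tonelli F hF Ξ t₀ (h k) (X k) t = X k t := by
    intro k t ht
    have := tonelli_iterate_eq (F := F) (hF := hF) (ξ := Ξ) (t₀ := t₀) (hh k) ((k + 1) ^ 2) t (by
      have hk : (k : ℝ) + 1 ≠ 0 := by positivity
      have : (((k + 1) ^ 2 : ℕ) : ℝ) * h k = k + 1 := by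
        simp only [h]; push_cast; field_simp
      linarith)
    rwa [Function.iterate_succ_apply'] at this
  obtain ⟨x, -, φ, hφ, hlim⟩ := (isCompact_tonelliRange Ξ t₀ M).tendsto_subseq hXmem
  have hlimt : ∀ t, Tendsto (fun k => X (φ k) t) atTop (𝓝 (x t)) := fun t =>
    ((continuous_eval_const (F := C(ℝ, Vec n)) t).tendsto x).comp hlim
  have hh0 : Tendsto (fun k => h (φ k)) atTop (𝓝 0) :=
    tendsto_one_div_add_atTop_nhds_zero_nat.comp hφ.tendsto_atTop
  have hc : ∀ y : C(ℝ, Vec n), Continuous fun s => F (segC Δ y s) := fun y =>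
    hF.comp (continuous_segC.comp (continuous_const.prodMk continuous_id))
  have key : ∀ t, x t = ξ (min t t₀) + ∫ s in t₀..max t t₀, F (segC Δ x s) := by
    intro t
    have h1 : Tendsto (fun k => ∫ s in t₀..max t t₀, F (segC Δ (X (φ k)) s)) atTop
        (𝓝 (∫ s in t₀..max t t₀, F (segC Δ x s))) := by
      refine intervalIntegral.tendsto_integral_filter_of_dominated_convergence (fun _ => M)
        (Eventually.of_forall fun k => (hc _).aestronglyMeasurable)
        (Eventually.of_forall fun k => Eventually.of_forall fun s _ => hM _)
        intervalIntegrable_const (Eventually.of_forall fun s _ => ?_)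
      exact (hF.tendsto _).comp ((continuous_segC.tendsto (x, s)).comp
        (hlim.prodMk_nhds tendsto_const_nhds))
    have h2 : Tendsto (fun k => X (φ k) t - (ξ (min t t₀) +
        ∫ s in t₀..max t t₀, F (segC Δ (X (φ k)) s))) atTop (𝓝 0) := by
      have hb : Tendsto (fun k => M * h (φ k)) atTop (𝓝 0) := by simpa using hh0.const_mul M
      refine squeeze_zero_norm' ?_ hb
      filter_upwards [hφ.tendsto_atTop.eventually_ge_atTop ⌈t - t₀⌉₊] with k hk
      have ht : t ≤ t₀ + ((φ k : ℕ) + 1) := by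
        have := (Nat.le_ceil (t - t₀)).trans (Nat.cast_le.mpr hk)
        linarith
      rw [← hXeq (φ k) t ht, tonelli_apply]
      change ‖ξ (min t t₀) + _ - _‖ ≤ _
      rw [add_sub_add_left_eq_sub, intervalIntegral.integral_interval_sub_left
        ((hc _).intervalIntegrable _ _) ((hc _).intervalIntegrable _ _)]
      refine (intervalIntegral.norm_integral_le_of_norm_le_const fun r _ => hM _).trans ?_
      refine mul_le_mul_of_nonneg_left ?_ hM0
      refine (abs_max_sub_max_le_abs _ _ _).trans ?_
      rw [show t - h (φ k) - t = -h (φ k) by ring, abs_neg, abs_of_nonneg (hh _)]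
    have h3 := (hlimt t).sub (h1.const_add (ξ (min t t₀)))
    exact sub_eq_zero.mp (tendsto_nhds_unique h3 h2)
  refine ⟨x, x.continuous, fun t ht => ?_, fun t ht => ?_⟩
  · rw [key, max_eq_right ht, min_eq_left ht, intervalIntegral.integral_same, add_zero]
  · rw [key, max_eq_left ht, min_eq_right ht]
    simp only [seg_eq_segC]

end Existence

/-! ### Local existence by truncation -/

section LocalExistence

variable {Δ : ℝ} {n : ℕ}

/-- Radial truncation of `F` to the ball of radius `M`; it does not change `F` where `‖F φ‖ ≤ M`. -/
noncomputable def radialTrunc (M : ℝ) (F : Hist Δ n → Vec n) (φ : Hist Δ n) : Vec n :=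
  (M / max M ‖F φ‖) • F φ

lemma continuous_radialTrunc {M : ℝ} (hM : 0 < M) {F : Hist Δ n → Vec n} (hF : Continuous F) :
    Continuous (radialTrunc M F) :=
  (continuous_const.div (continuous_const.max hF.norm)
    fun _ => (hM.trans_le (le_max_left _ _)).ne').smul hF

lemma norm_radialTrunc_le {M : ℝ} (hM : 0 < M) (F : Hist Δ n → Vec n) (φ : Hist Δ n) :
    ‖radialTrunc M F φ‖ ≤ M := by
  have h : 0 < max M ‖F φ‖ := hM.trans_le (le_max_left _ _)
  rw [radialTrunc, norm_smul, Real.norm_of_nonneg (by positivity), div_mul_eq_mul_div,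
    div_le_iff₀ h]
  exact mul_le_mul_of_nonneg_left (le_max_right _ _) hM.le

lemma radialTrunc_eq {M : ℝ} (hM : 0 < M) {F : Hist Δ n → Vec n} {φ : Hist Δ n}
    (h : ‖F φ‖ ≤ M) : radialTrunc M F φ = F φ := by
  rw [radialTrunc, max_eq_left h, div_self hM.ne', one_smul]

lemma hasDerivAt_of_eq_integral {x G : ℝ → Vec n} (hG : Continuous G) {c : Vec n} {t₀ t : ℝ}
    (ht : t₀ < t) (h : ∀ s, t₀ ≤ s → x s = c + ∫ r in t₀..s, G r) : HasDerivAt x (G t) t := by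
  have h1 : HasDerivAt (fun s => c + ∫ r in t₀..s, G r) (G t) t :=
    (hG.integral_hasStrictDerivAt t₀ t).hasDerivAt.const_add c
  refine h1.congr_of_eventuallyEq ?_
  filter_upwards [lt_mem_nhds ht] with s hs using h s hs.le

lemma seg_zero_eq {ξ : Hist Δ n} {x : ℝ → Vec n} (h : ∀ θ : Icc (-Δ) (0 : ℝ), x θ = ξ θ) :
    seg Δ x 0 = ξ := by
  have hc : Continuous fun θ : Icc (-Δ) (0 : ℝ) => x (0 + θ) := by
    simpa only [zero_add, h] using ξ.continuous
  rw [seg, dif_pos hc]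
  ext1 θ
  simpa using h θ

/-- The extension of a history to the whole line that is constant outside `[-Δ, 0]`. -/
noncomputable def Hist.extend [hΔ : Fact (0 < Δ)] (ξ : Hist Δ n) : ℝ → Vec n :=
  IccExtend (by have := hΔ.out; linarith : -Δ ≤ (0 : ℝ)) ξ

variable [hΔ : Fact (0 < Δ)]

lemma Hist.continuous_extend (ξ : Hist Δ n) : Continuous ξ.extend :=
  ξ.continuous.Icc_extend'

lemma Hist.extend_apply (ξ : Hist Δ n) (θ : Icc (-Δ) (0 : ℝ)) : ξ.extend θ = ξ θ :=
  IccExtend_val _ _ θ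

/-- **Peano's theorem** for delay equations: local existence for a continuous right-hand side.
Near `t = 0` a solution of the equation truncated at the level `‖F ξ‖ + 1` does not feel the
truncation. -/
theorem exists_isSolutionOn {F : Hist Δ n → Vec n} (hF : Continuous F) (ξ : Hist Δ n) :
    ∃ (T : ℝ) (x : ℝ → Vec n), 0 < T ∧ IsSolutionOn F ξ T x := by
  have hM : 0 < ‖F ξ‖ + 1 := by positivity
  have hc := continuous_radialTrunc hM hF
  obtain ⟨x, hx, hx0, hxi⟩ := exists_global_solution_of_bounded hc
    (norm_radialTrunc_le hM F) ξ.continuous_extend 0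
  have hini : ∀ θ : Icc (-Δ) (0 : ℝ), x θ = ξ θ := fun θ => by
    rw [hx0 θ θ.2.2, ξ.extend_apply]
  have hseg := continuous_seg (Δ := Δ) hx
  have hev : ∀ᶠ t in 𝓝 (0 : ℝ), ‖F (seg Δ x t)‖ < ‖F ξ‖ + 1 := by
    refine (hF.comp hseg).norm.continuousAt.eventually_lt continuousAt_const ?_
    simp [seg_zero_eq hini]
  obtain ⟨T, hT, hball⟩ := Metric.eventually_nhds_iff.mp hev
  refine ⟨T, x, hT, hx.continuousOn, hini, fun t ht => ?_⟩
  have h1 := hasDerivAt_of_eq_integral (hc.comp hseg) ht.1 hxi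
  rwa [Function.comp_apply, radialTrunc_eq hM (hball (by
    rw [dist_zero_right, Real.norm_of_nonneg ht.1.le]; exact ht.2)).le] at h1

end LocalExistence

/-! ### Continuation of bounded solutions -/

section Continuation

variable {Δ : ℝ} {n : ℕ} [hΔ : Fact (0 < Δ)]

/-- A solution on `[-Δ, T)`, `T` finite, with bounded velocity agrees with a function that is
continuous on the whole line. -/
lemma IsSolutionOn.exists_continuous_extension {F : Hist Δ n → Vec n} {ξ : Hist Δ n} {T : ℝ}
    {x : ℝ → Vec n} (hx : IsSolutionOn F ξ T x) (hT : 0 < T) {K : ℝ}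
    (hK : ∀ t ∈ Ioo 0 T, ‖F (seg Δ x t)‖ ≤ K) :
    ∃ X : ℝ → Vec n, Continuous X ∧ EqOn X x (Ico (-Δ) T) := by
  have hΔ' := hΔ.out
  have hlip : LipschitzOnWith K.toNNReal x (Ioo 0 T) :=
    (convex_Ioo 0 T).lipschitzOnWith_of_nnnorm_hasDerivWithin_le
      (fun t ht => (hx.hasDerivAt t ht).hasDerivWithinAt)
      (fun t ht => by
        rw [← NNReal.coe_le_coe, coe_nnnorm]
        exact (hK t ht).trans (Real.le_coe_toNNReal K))
  obtain ⟨g, hg, hgx⟩ := hlip.extend_finite_dimension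
  have hnow : (0 : ℝ) ∈ Icc (-Δ) (0 : ℝ) := ⟨by linarith, le_rfl⟩
  have hg0 : g 0 = x 0 := by
    have h1 : Tendsto g (𝓝[>] 0) (𝓝 (g 0)) := hg.continuous.continuousWithinAt
    have h2 : Tendsto x (𝓝[>] 0) (𝓝 (x 0)) := by
      refine (hx.continuousOn 0 ⟨by linarith, hT⟩).tendsto.mono_left ?_
      rw [← nhdsWithin_Ioo_eq_nhdsGT hT]
      exact nhdsWithin_mono _ fun t ht => ⟨by linarith [ht.1], ht.2⟩
    refine tendsto_nhds_unique (h1.congr' ?_) h2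
    filter_upwards [Ioo_mem_nhdsGT hT] with t ht using hgx.symm ht ▸ rfl
  refine ⟨fun t => if t ≤ 0 then ξ.extend t else g t,
    ξ.continuous_extend.if_le hg.continuous continuous_id continuous_const ?_, ?_⟩
  · rintro t rfl
    rw [hg0, ξ.extend_apply ⟨_, hnow⟩, ← hx.initial ⟨_, hnow⟩]
  · intro t ht
    simp only
    split_ifs with h
    · rw [ξ.extend_apply ⟨t, ht.1, h⟩, ← hx.initial ⟨t, ht.1, h⟩]
    · exact (hgx ⟨not_le.mp h, ht.2⟩).symm

/-- If the right-hand side maps bounded sets to bounded sets, then global asymptotic stability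
excludes finite escape, so that every solution can be continued to all times. -/
theorem IsGAS.exists_isGlobalSolution {F : Hist Δ n → Vec n} (hF : Continuous F)
    (hgas : IsGAS F) (hb : MapsBoundedToBounded F) (ξ : Hist Δ n) (T : ℝ) (x : ℝ → Vec n)
    (hT : 0 < T) (hx : IsSolutionOn F ξ T x) :
    ∃ z : ℝ → Vec n, IsGlobalSolution F ξ z ∧ ∀ t ∈ Ico (-Δ) T, z t = x t := by
  have hΔ' := hΔ.out
  obtain ⟨β, hβ, hsol⟩ := hgas
  set R := max ‖ξ‖ (β ‖ξ‖ 0)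
  have hR : 0 ≤ R := (norm_nonneg ξ).trans (le_max_left _ _)
  have hbd : ∀ (T' : ℝ) (x' : ℝ → Vec n), 0 < T' → IsSolutionOn F ξ T' x' →
      ∀ t < T', 0 ≤ t → ‖seg Δ x' t‖ ≤ R := by
    intro T' x' hT' hx' t htT ht0
    refine norm_seg_le hR fun s hs => ?_
    rcases le_total s 0 with h | h
    · have hs' : s ∈ Icc (-Δ) (0 : ℝ) := ⟨by linarith [hs.1], h⟩
      rw [hx'.initial ⟨s, hs'⟩]
      exact (ξ.norm_coe_le_norm _).trans (le_max_left _ _)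
    · refine (hsol ξ T' x' hT' hx' s ⟨h, hs.2.trans_lt htT⟩).trans ?_
      exact (hβ.antitoneOn _ (norm_nonneg ξ) self_mem_Ici h h).trans (le_max_right _ _)
  obtain ⟨K, hK⟩ := hb (R + 1)
  have hM : 0 < max K 1 := lt_max_of_lt_right one_pos
  have htr : ∀ φ : Hist Δ n, ‖φ‖ ≤ R + 1 → radialTrunc (max K 1) F φ = F φ := fun φ hφ =>
    radialTrunc_eq hM ((hK φ hφ).trans (le_max_left _ _))
  have hcF := continuous_radialTrunc hM hF
  have hbx : ∀ t ∈ Ioo 0 T, ‖seg Δ x t‖ ≤ R + 1 := fun t ht =>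
    (hbd T x hT hx t ht.2 ht.1.le).trans (by linarith)
  obtain ⟨X, hX, hXx⟩ := hx.exists_continuous_extension hT fun t ht => hK _ (hbx t ht)
  -- continue `X` beyond `T` by a solution of the truncated equation
  obtain ⟨z, hz, hzX, hzi⟩ := exists_global_solution_of_bounded hcF
    (norm_radialTrunc_le hM F) hX T
  have hzx : ∀ t ∈ Ico (-Δ) T, z t = x t := fun t ht => (hzX t ht.2.le).trans (hXx ht)
  have hini : ∀ θ : Icc (-Δ) (0 : ℝ), z θ = ξ θ := fun θ => by
    rw [hzx θ ⟨θ.2.1, θ.2.2.trans_lt hT⟩, hx.initial]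
  have hG : Continuous fun s => radialTrunc (max K 1) F (seg Δ z s) :=
    hcF.comp (continuous_seg hz)
  have hderiv : ∀ t ∈ Ioo 0 T, HasDerivAt z (radialTrunc (max K 1) F (seg Δ z t)) t := by
    intro t ht
    have hseg : seg Δ z t = seg Δ x t :=
      seg_congr fun s hs => hzx s ⟨by linarith [hs.1, ht.1], hs.2.trans_lt ht.2⟩
    rw [hseg, htr _ (hbx t ht)]
    refine (hx.hasDerivAt t ht).congr_of_eventuallyEq ?_
    filter_upwards [Ioo_mem_nhds ht.1 ht.2] with s hs
    exact hzx s ⟨by linarith [hs.1], hs.2⟩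
  have hint : ∀ t, 0 ≤ t → z t = z 0 + ∫ s in (0 : ℝ)..t, radialTrunc (max K 1) F (seg Δ z s) := by
    have h1 : ∀ t, 0 ≤ t → t ≤ T →
        z t = z 0 + ∫ s in (0 : ℝ)..t, radialTrunc (max K 1) F (seg Δ z s) := by
      intro t h0 h1
      rw [intervalIntegral.integral_eq_sub_of_hasDerivAt_of_le h0 hz.continuousOn
        (fun s hs => hderiv s ⟨hs.1, hs.2.trans_le h1⟩) (hG.intervalIntegrable _ _)]
      abel
    intro t ht
    rcases le_total t T with h | h
    · exact h1 t ht h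
    · rw [hzi t h, ← hzX T le_rfl, h1 T hT.le le_rfl, add_assoc,
        intervalIntegral.integral_add_adjacent_intervals (hG.intervalIntegrable _ _)
          (hG.intervalIntegrable _ _)]
  have hsolz : ∀ T' : ℝ, (∀ t ∈ Ioo 0 T', ‖seg Δ z t‖ ≤ R + 1) → IsSolutionOn F ξ T' z := by
    refine fun T' h => ⟨hz.continuousOn, hini, fun t ht => ?_⟩
    rw [← htr _ (h t ht)]
    exact hasDerivAt_of_eq_integral hG ht.1 hint
  -- continuous induction: the bound `R` persists, since beyond a time up to which it holds the
  -- truncation stays inactive for a while, and `z` still solves the original equation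
  have hbz : ∀ N : ℝ, Icc 0 N ⊆ {t | ‖seg Δ z t‖ ≤ R} := by
    intro N
    have hcl : IsClosed {t | ‖seg Δ z t‖ ≤ R} :=
      isClosed_le (continuous_seg hz).norm continuous_const
    refine (hcl.inter isClosed_Icc).Icc_subset_of_forall_mem_nhdsGT_of_Icc_subset ?_ ?_
    · change ‖seg Δ z 0‖ ≤ R
      rw [seg_zero_eq hini]
      exact le_max_left _ _
    · intro t ht hsub
      have hev : ∀ᶠ r in 𝓝 t, ‖seg Δ z r‖ < R + 1 := by
        refine (continuous_seg hz).norm.continuousAt.eventually_lt continuousAt_const ?_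
        have : ‖seg Δ z t‖ ≤ R := hsub ⟨ht.1, le_rfl⟩
        linarith
      obtain ⟨ε, hε, hball⟩ := Metric.eventually_nhds_iff.mp hev
      have hs := hsolz (t + ε) fun r hr => by
        rcases le_total r t with h | h
        · have : ‖seg Δ z r‖ ≤ R := hsub ⟨hr.1.le, h⟩
          linarith
        · refine (hball ?_).le
          rw [Real.dist_eq, abs_of_nonneg (by linarith)]
          linarith [hr.2]
      have htε : 0 < t + ε := by linarith [ht.1]
      filter_upwards [Ioo_mem_nhdsGT (by linarith : t < t + ε)] with r hr
      exact hbd (t + ε) z htε hs r hr.2 (ht.1.trans hr.1.le)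
  exact ⟨z, fun T' _ => hsolz T' fun t ht =>
    (hbz T' ⟨ht.1.le, ht.2.le⟩ : ‖seg Δ z t‖ ≤ R).trans (by linarith), hzx⟩

end Continuation

/-! ### Comparison functions -/

lemma ClassK.nonneg {α : ℝ → ℝ} (h : ClassK α) {s : ℝ} (hs : 0 ≤ s) : 0 ≤ α s :=
  h.map_zero ▸ h.strictMonoOn.monotoneOn self_mem_Ici hs hs

/-- A class `K_∞` function has a right inverse of class `K`. -/
lemma ClassKInf.exists_rightInverse {k : ℝ → ℝ} (hk : ClassKInf k) :
    ∃ k' : ℝ → ℝ, ClassK k' ∧ ∀ s, 0 ≤ s → k (k' s) = s := by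
  let K : Ici (0 : ℝ) → Ici (0 : ℝ) := fun s => ⟨k s, hk.toClassK.nonneg s.2⟩
  have hmono : StrictMono K := fun a b hab => hk.strictMonoOn a.2 b.2 hab
  have hsurj : Function.Surjective K := by
    rintro ⟨y, hy⟩
    obtain ⟨s, hs, hys⟩ := hk.unbounded y
    have hivt := intermediate_value_Icc hs (hk.continuousOn.mono Icc_subset_Ici_self)
    rw [hk.map_zero] at hivt
    obtain ⟨r, hr, hry⟩ := hivt ⟨hy, hys.le⟩
    exact ⟨⟨r, hr.1⟩, Subtype.ext hry⟩
  let e : Ici (0 : ℝ) ≃o Ici (0 : ℝ) := hmono.orderIsoOfSurjective K hsurj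
  have he : ∀ s, K (e.symm s) = s := fun s => e.apply_symm_apply s
  have hproj : ∀ {s : ℝ} (hs : 0 ≤ s), projIci 0 s = ⟨s, hs⟩ := fun hs => projIci_of_mem hs
  refine ⟨fun s => e.symm (projIci 0 s), ⟨?_, ?_, ?_⟩, ?_⟩
  · exact Continuous.continuousOn (continuous_subtype_val.comp (e.symm.continuous.comp
      (by unfold projIci; fun_prop)))
  · have h0 : e.symm ⟨0, self_mem_Ici⟩ = ⟨0, self_mem_Ici⟩ := by
      rw [OrderIso.symm_apply_eq]
      exact Subtype.ext hk.map_zero.symm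
    simp only [hproj le_rfl, h0]
  · intro a ha b hb hab
    simp only [hproj ha, hproj hb]
    exact e.symm.strictMono hab
  · intro s hs
    simp only [hproj hs]
    exact congrArg Subtype.val (he ⟨s, hs⟩)

/-- The `KL` function of the decay estimate: `β(s, t)` is the solution `c` of
`α₁(c) + t γ(α₁(c)) = α₂(s)`. -/
lemma exists_classKL {α₁ α₂ γ : ℝ → ℝ} (h₁ : ClassKInf α₁) (h₂ : ClassK α₂) (hγ : ClassK γ) :
    ∃ β : ℝ → ℝ → ℝ, ClassKL β ∧ ∀ s t, 0 ≤ s → 0 ≤ t → 0 ≤ β s t ∧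
      α₁ (β s t) + t * γ (α₁ (β s t)) = α₂ s := by
  have hα : MapsTo α₁ (Ici 0) (Ici 0) := fun c hc => h₁.toClassK.nonneg hc
  have hmono : MonotoneOn (fun c => γ (α₁ c)) (Ici 0) := fun a ha b hb hab =>
    hγ.strictMonoOn.monotoneOn (hα ha) (hα hb) (h₁.strictMonoOn.monotoneOn ha hb hab)
  have hγα : ∀ c, 0 ≤ c → 0 ≤ γ (α₁ c) := fun c hc => hγ.nonneg (hα hc)
  have hk : ∀ t, 0 ≤ t → ClassKInf fun c => α₁ c + t * γ (α₁ c) := by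
    refine fun t ht => ⟨⟨?_, ?_, ?_⟩, fun M => ?_⟩
    · exact h₁.continuousOn.add (continuousOn_const.mul
        (hγ.continuousOn.comp h₁.continuousOn hα))
    · simp [h₁.map_zero, hγ.map_zero]
    · exact fun a ha b hb hab => add_lt_add_of_lt_of_le (h₁.strictMonoOn ha hb hab)
        (mul_le_mul_of_nonneg_left (hmono ha hb hab.le) ht)
    · obtain ⟨s, hs, hM⟩ := h₁.unbounded M
      exact ⟨s, hs, hM.trans_le (le_add_of_nonneg_right (mul_nonneg ht (hγα s hs)))⟩
  have hex : ∀ t : ℝ, ∃ k' : ℝ → ℝ, 0 ≤ t → ClassK k' ∧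
      ∀ s, 0 ≤ s → α₁ (k' s) + t * γ (α₁ (k' s)) = s := by
    intro t
    by_cases ht : 0 ≤ t
    · obtain ⟨k', h, h'⟩ := (hk t ht).exists_rightInverse
      exact ⟨k', fun _ => ⟨h, h'⟩⟩
    · exact ⟨0, fun h => absurd h ht⟩
  choose k' hk' using hex
  have hβ : ∀ s t, 0 ≤ s → 0 ≤ t → 0 ≤ k' t (α₂ s) ∧
      α₁ (k' t (α₂ s)) + t * γ (α₁ (k' t (α₂ s))) = α₂ s := fun s t hs ht =>
    ⟨(hk' t ht).1.nonneg (h₂.nonneg hs), (hk' t ht).2 _ (h₂.nonneg hs)⟩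
  refine ⟨fun s t => k' t (α₂ s), ⟨fun t ht => ⟨?_, ?_, ?_⟩, fun s hs t ht t' ht' htt' => ?_,
    fun s hs => ?_⟩, hβ⟩
  · exact (hk' t ht).1.continuousOn.comp h₂.continuousOn fun s hs => h₂.nonneg hs
  · simp only [h₂.map_zero, (hk' t ht).1.map_zero]
  · exact fun a ha b hb hab => (hk' t ht).1.strictMonoOn (h₂.nonneg ha) (h₂.nonneg hb)
      (h₂.strictMonoOn ha hb hab)
  · obtain ⟨h0, h1⟩ := hβ s t hs ht
    obtain ⟨h0', h1'⟩ := hβ s t' hs ht'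
    by_contra! hlt
    have h2 := (hk t ht).strictMonoOn h0 h0' hlt
    have h3 := mul_le_mul_of_nonneg_right htt' (hγα _ h0')
    linarith
  · rw [Metric.tendsto_atTop]
    intro ε hε
    have hpos : 0 < γ (α₁ ε) := by
      have h1 := h₁.strictMonoOn self_mem_Ici hε.le hε
      rw [h₁.map_zero] at h1
      have h2 := hγ.strictMonoOn self_mem_Ici h1.le h1
      rwa [hγ.map_zero] at h2
    refine ⟨α₂ s / γ (α₁ ε) + 1, fun t ht => ?_⟩
    have hdiv : 0 ≤ α₂ s / γ (α₁ ε) := div_nonneg (h₂.nonneg hs) hpos.le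
    have ht0 : 0 ≤ t := by linarith
    obtain ⟨h0, h1⟩ := hβ s t hs ht0
    rw [Real.dist_0_eq_abs, abs_of_nonneg h0]
    by_contra! hle
    have h2 := mul_le_mul_of_nonneg_left (hmono hε.le h0 hle) ht0
    have h3 : α₂ s < t * γ (α₁ ε) := by
      rw [← div_lt_iff₀ hpos]
      linarith
    have h4 : 0 ≤ α₁ (k' t (α₂ s)) := hα h0
    simp only at h2
    linarith

/-! ### Decay along solutions -/

lemma le_sub_of_hasDerivWithinAt_le {W d : ℝ → ℝ} {a b k : ℝ} (hab : a ≤ b)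
    (hW : ContinuousOn W (Icc a b)) (hd : ∀ t ∈ Ico a b, HasDerivWithinAt W (d t) (Ici t) t)
    (hk : ∀ t ∈ Ico a b, d t ≤ -k) : W b ≤ W a - k * (b - a) := by
  refine image_le_of_deriv_right_le_deriv_boundary (B := fun t => W a - k * (t - a))
    (B' := fun _ => -k) hW hd (by simp) (by fun_prop) (fun t _ => ?_) hk (right_mem_Icc.mpr hab)
  have := ((hasDerivAt_id t).sub_const a).const_mul k |>.const_sub (W a)
  simpa using this.hasDerivWithinAt

/-- Comparison without solving `w' = -γ(w)`: if `W` stayed above `c` up to time `T`, it would have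
lost at least `T γ(c)`. -/
lemma le_of_decay {W d γ : ℝ → ℝ} {T c : ℝ} (hT : 0 ≤ T) (hc : 0 ≤ c) (hγ : ClassK γ)
    (hW0 : ∀ t, 0 ≤ W t) (hW : ContinuousOn W (Icc 0 T))
    (hd : ∀ t ∈ Ioo 0 T, HasDerivWithinAt W (d t) (Ici t) t)
    (hdecay : ∀ t ∈ Ioo 0 T, d t ≤ -γ (W t)) (hle : W 0 ≤ c + T * γ c) : W T ≤ c := by
  rcases hT.eq_or_lt with rfl | hT
  · simpa using hle
  by_contra! hlt
  have hanti : ∀ s ∈ Ioo 0 T, W T ≤ W s := by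
    intro s hs
    have := le_sub_of_hasDerivWithinAt_le (k := 0) hs.2.le
      (hW.mono (Icc_subset_Icc_left hs.1.le))
      (fun t ht => hd t ⟨hs.1.trans_le ht.1, ht.2⟩)
      (fun t ht => (hdecay t ⟨hs.1.trans_le ht.1, ht.2⟩).trans
        (neg_le_neg (hγ.nonneg (hW0 t))))
    simpa using this
  have hstep : ∀ s ∈ Ioo 0 T, W T + γ c * (T - s) ≤ W s := by
    intro s hs
    have := le_sub_of_hasDerivWithinAt_le (k := γ c) hs.2.le
      (hW.mono (Icc_subset_Icc_left hs.1.le))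
      (fun t ht => hd t ⟨hs.1.trans_le ht.1, ht.2⟩)
      (fun t ht => by
        have ht' : t ∈ Ioo 0 T := ⟨hs.1.trans_le ht.1, ht.2⟩
        exact (hdecay t ht').trans (neg_le_neg (hγ.strictMonoOn.monotoneOn hc (hW0 t)
          (hlt.le.trans (hanti t ht')))))
    linarith
  have hlim : W T + γ c * (T - 0) ≤ W 0 := by
    have h1 : Tendsto W (𝓝[>] 0) (𝓝 (W 0)) := by
      refine (hW 0 ⟨le_rfl, hT.le⟩).tendsto.mono_left ?_
      rw [← nhdsWithin_Ioo_eq_nhdsGT hT]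
      exact nhdsWithin_mono _ Ioo_subset_Icc_self
    have h2 : Tendsto (fun s => W T + γ c * (T - s)) (𝓝[>] 0) (𝓝 (W T + γ c * (T - 0))) :=
      ((by fun_prop : Continuous fun s => W T + γ c * (T - s)).tendsto 0).mono_left
        nhdsWithin_le_nhds
    refine le_of_tendsto_of_tendsto h2 h1 ?_
    filter_upwards [Ioo_mem_nhdsGT hT] with s hs using hstep s hs
  linarith [mul_comm T (γ c)]

section Lyapunov

variable {Δ : ℝ} {n : ℕ} [hΔ : Fact (0 < Δ)]

lemma continuous_now : Continuous (now : Hist Δ n → Vec n) :=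
  continuous_eval_const _

lemma now_seg {x : ℝ → Vec n} (hx : Continuous x) (t : ℝ) : now (seg Δ x t) = x t := by
  rw [now, seg_apply_of_continuous hx]
  simp

lemma IsSmoothlySeparable.continuous_sepFunctional {V₁ : Vec n → ℝ} {V₂ : Hist Δ n → ℝ}
    (h : IsSmoothlySeparable V₁ V₂) : Continuous (sepFunctional V₁ V₂) :=
  (h.contDiff.continuous.comp continuous_now).add h.locallyLipschitz.continuous

/-- Chain rule: invariant differentiability gives the right derivative of `t ↦ V(x_t)` at every
point of differentiability of `x`. -/
lemma IsContIDifferentiable.hasDerivWithinAt_sepFunctional {V₁ : Vec n → ℝ} {V₂ : Hist Δ n → ℝ}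
    (h : IsContIDifferentiable V₁ V₂) {x : ℝ → Vec n} (hx : Continuous x) {t : ℝ} {v : Vec n}
    (hv : HasDerivAt x v t) :
    HasDerivWithinAt (fun s => sepFunctional V₁ V₂ (seg Δ x s))
      (fderiv ℝ V₁ (x t) v + dini V₂ (seg Δ x t)) (Ici t) t := by
  have hext : IsExtension (seg Δ x t) fun s => x (t + s) :=
    ⟨by fun_prop, fun θ => (seg_apply_of_continuous hx t θ).symm⟩
  have hmap : Tendsto (fun s => (x s - x t, s - t)) (𝓝[Ici t] t)
      (𝓝[{p : Vec n × ℝ | 0 ≤ p.2}] 0) := by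
    refine tendsto_nhdsWithin_iff.mpr ⟨?_, ?_⟩
    · have : Continuous fun s => (x s - x t, s - t) := by fun_prop
      simpa using! (this.tendsto t).mono_left nhdsWithin_le_nhds
    · filter_upwards [self_mem_nhdsWithin] with s hs
      exact sub_nonneg.mpr hs
  have h1 := (h.expansion (x t) (seg Δ x t) _ hext).comp_tendsto hmap
  have h2 : (fun s => √(‖x s - x t‖ ^ 2 + (s - t) ^ 2)) =O[𝓝[Ici t] t] fun s => s - t := by
    have hO : (fun s => x s - x t) =O[𝓝[Ici t] t] fun s => s - t :=
      hv.isBigO_sub.mono nhdsWithin_le_nhds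
    refine Asymptotics.IsBigO.trans (g := fun s => ‖x s - x t‖ + ‖s - t‖)
      (Asymptotics.IsBigO.of_bound 1 (Eventually.of_forall fun s => ?_))
      (hO.norm_left.add (Asymptotics.isBigO_refl _ _).norm_left)
    rw [one_mul, Real.norm_of_nonneg (Real.sqrt_nonneg _), Real.norm_of_nonneg (by positivity),
      Real.sqrt_le_left (by positivity), ← sq_abs (s - t), ← Real.norm_eq_abs]
    nlinarith [norm_nonneg (x s - x t), norm_nonneg (s - t)]
  have h3 : (fun s => fderiv ℝ V₁ (x t) (x s - x t - (s - t) • v)) =o[𝓝[Ici t] t]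
      fun s => s - t :=
    ((fderiv ℝ V₁ (x t)).isBigO_comp _ _).trans_isLittleO
      ((hasDerivAt_iff_isLittleO.mp hv).mono nhdsWithin_le_nhds)
  rw [hasDerivWithinAt_iff_isLittleO]
  refine ((h1.trans_isBigO h2).add h3).congr_left fun s => ?_
  simp only [Function.comp_apply, sepFunctional, now_seg hx, seg_comp_add, map_sub, map_smul,
    smul_eq_mul, add_sub_cancel]
  ring

/-- **Lyapunov–Krasovskii theorem**: strict decrease of `V` along the vector field `F` implies
global asymptotic stability. -/
theorem isGAS_of_decay {V₁ : Vec n → ℝ} {V₂ : Hist Δ n → ℝ} {γ : ℝ → ℝ}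
    (hs : IsSmoothlySeparable V₁ V₂) (hI : IsContIDifferentiable V₁ V₂)
    (hb : ∃ α₁ α₂ : ℝ → ℝ, ClassKInf α₁ ∧ ClassKInf α₂ ∧ ∀ φ : Hist Δ n,
      α₁ ‖now φ‖ ≤ sepFunctional V₁ V₂ φ ∧ sepFunctional V₁ V₂ φ ≤ α₂ ‖φ‖)
    (hγ : ClassK γ) {F : Hist Δ n → Vec n}
    (hF : ∀ φ, fderiv ℝ V₁ (now φ) (F φ) + dini V₂ φ ≤ -γ (sepFunctional V₁ V₂ φ)) :
    IsGAS F := by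
  have hΔ' := hΔ.out
  obtain ⟨α₁, α₂, h₁, h₂, hα⟩ := hb
  obtain ⟨β, hβ, hβeq⟩ := exists_classKL h₁ h₂.toClassK hγ
  refine ⟨β, hβ, fun ξ T x hT hx t ht => ?_⟩
  obtain ⟨h0, heq⟩ := hβeq ‖ξ‖ t (norm_nonneg ξ) ht.1
  -- replace `x` by a globally continuous function with the same values on `[-Δ, t]`
  have hle : -Δ ≤ t := by linarith [ht.1]
  let X : ℝ → Vec n := IccExtend hle ((Icc (-Δ) t).domRestrict x)
  have hX : Continuous X :=
    (continuousOn_iff_continuous_domRestrict.mp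
      (hx.continuousOn.mono fun s hs => ⟨hs.1, hs.2.trans_lt ht.2⟩)).Icc_extend'
  have hXx : ∀ s ∈ Icc (-Δ) t, X s = x s := fun s hs => IccExtend_of_mem hle _ hs
  have hX0 : seg Δ X 0 = ξ := by
    ext1 θ
    rw [seg_apply_of_continuous hX, zero_add, hXx θ ⟨θ.2.1, θ.2.2.trans ht.1⟩, hx.initial]
  have hXd : ∀ s ∈ Ioo 0 t, HasDerivAt X (F (seg Δ X s)) s := by
    intro s hs
    have hseg : seg Δ X s = seg Δ x s :=
      seg_congr fun r hr => hXx r ⟨by linarith [hr.1, hs.1], hr.2.trans hs.2.le⟩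
    rw [hseg]
    refine (hx.hasDerivAt s ⟨hs.1, hs.2.trans ht.2⟩).congr_of_eventuallyEq ?_
    filter_upwards [Ioo_mem_nhds hs.1 hs.2] with r hr
    exact hXx r ⟨by linarith [hr.1], hr.2.le⟩
  have hWt : sepFunctional V₁ V₂ (seg Δ X t) ≤ α₁ (β ‖ξ‖ t) := by
    refine le_of_decay (W := fun s => sepFunctional V₁ V₂ (seg Δ X s)) ht.1
      (h₁.toClassK.nonneg h0) hγ (fun s => add_nonneg (hs.nonneg₁ _) (hs.nonneg₂ _))
      (hs.continuous_sepFunctional.comp (continuous_seg hX)).continuousOn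
      (fun s hs' => hI.hasDerivWithinAt_sepFunctional hX (hXd s hs')) (fun s _ => ?_) ?_
    · have := hF (seg Δ X s)
      rwa [now_seg hX] at this
    · simp only [hX0, heq]
      exact (hα ξ).2
  have hfin := (hα (seg Δ X t)).1.trans hWt
  rw [now_seg hX, hXx t ⟨hle, le_rfl⟩] at hfin
  exact (h₁.strictMonoOn.le_iff_le (norm_nonneg _) h0).mp hfin

end Lyapunov

/-! ### Sontag's formula -/

section Sontag

variable {m : ℕ} {lam p : ℝ} {q : Vec m}

lemma inner_kappa (hq : q ≠ 0) : p + inner ℝ q (kappa lam p q) = -√(p ^ 2 + lam * ‖q‖ ^ 4) := by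
  have hq' : ‖q‖ ≠ 0 := norm_ne_zero_iff.mpr hq
  rw [kappa, if_neg hq, inner_smul_right, real_inner_self_eq_norm_sq]
  field_simp
  ring

/-- If the scalar problem `p + ⟪q, u⟫ ≤ 0` has a solution of norm at most `ε`, then Sontag's
formula gives a solution of comparable size. -/
lemma norm_kappa_le (hlam : 0 ≤ lam) {ε : ℝ} (hε : 0 ≤ ε) (hp : p ≤ ‖q‖ * ε) :
    ‖kappa lam p q‖ ≤ 2 * ε + √lam * ‖q‖ := by
  by_cases hq : q = 0
  · rw [kappa, if_pos hq, norm_zero]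
    positivity
  have hq' : 0 < ‖q‖ := norm_pos_iff.mpr hq
  have hupper : √(p ^ 2 + lam * ‖q‖ ^ 4) ≤ |p| + √lam * ‖q‖ ^ 2 := by
    rw [Real.sqrt_le_left (by positivity)]
    have h : (|p| + √lam * ‖q‖ ^ 2) ^ 2 =
        |p| ^ 2 + √lam ^ 2 * ‖q‖ ^ 4 + 2 * (|p| * (√lam * ‖q‖ ^ 2)) := by ring
    rw [h, sq_abs, Real.sq_sqrt hlam]
    exact le_add_of_nonneg_right (by positivity)
  have hlower : |p| ≤ √(p ^ 2 + lam * ‖q‖ ^ 4) :=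
    Real.abs_le_sqrt (le_add_of_nonneg_right (by positivity))
  have hpp : p + |p| ≤ 2 * (‖q‖ * ε) := by
    rcases abs_cases p with ⟨h, -⟩ | ⟨h, -⟩ <;> rw [h]
    · linarith
    · have := mul_nonneg hq'.le hε
      linarith
  rw [kappa, if_neg hq, norm_smul, Real.norm_eq_abs, abs_div, abs_neg, abs_of_nonneg
    (by linarith [neg_abs_le p] : 0 ≤ p + √(p ^ 2 + lam * ‖q‖ ^ 4)), abs_of_pos (by positivity),
    div_mul_eq_mul_div, div_le_iff₀ (by positivity)]
  nlinarith [mul_le_mul_of_nonneg_right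
    (by linarith : p + √(p ^ 2 + lam * ‖q‖ ^ 4) ≤ 2 * (‖q‖ * ε) + √lam * ‖q‖ ^ 2) hq'.le]

/-- Sontag's formula is continuous where `q ≠ 0` or `p < 0`. -/
lemma continuousAt_kappa (hlam : 0 ≤ lam) (h : q = 0 → p < 0) :
    ContinuousAt (fun r : ℝ × Vec m => kappa lam r.1 r.2) (p, q) := by
  by_cases hq : q = 0
  · subst hq
    have hev : ∀ᶠ r : ℝ × Vec m in 𝓝 (p, 0), r.1 < 0 :=
      continuousAt_fst.eventually_lt continuousAt_const (h rfl)
    have h0 : kappa lam p (0 : Vec m) = 0 := if_pos rfl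
    rw [ContinuousAt, h0]
    refine squeeze_zero_norm' (a := fun r : ℝ × Vec m => 2 * 0 + √lam * ‖r.2‖) ?_ ?_
    · filter_upwards [hev] with r hr
      exact norm_kappa_le hlam le_rfl (by simpa using hr.le)
    · have : Continuous fun r : ℝ × Vec m => 2 * 0 + √lam * ‖r.2‖ := by fun_prop
      simpa using this.tendsto (p, 0)
  · have hev : ∀ᶠ r : ℝ × Vec m in 𝓝 (p, q), r.2 ≠ 0 := continuousAt_snd.eventually_ne hq
    have hform : ContinuousAt (fun r : ℝ × Vec m =>
        ((r.1 + √(r.1 ^ 2 + lam * ‖r.2‖ ^ 4)) / (-‖r.2‖ ^ 2)) • r.2) (p, q) := by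
      have hnum : Continuous fun r : ℝ × Vec m => r.1 + √(r.1 ^ 2 + lam * ‖r.2‖ ^ 4) := by
        fun_prop
      have hden : Continuous fun r : ℝ × Vec m => -‖r.2‖ ^ 2 := by fun_prop
      exact (hnum.continuousAt.div hden.continuousAt (by simpa using hq)).smul continuousAt_snd
    refine hform.congr ?_
    filter_upwards [hev] with r hr
    rw [kappa, if_neg hr]

end Sontag

/-! ### The closed loop -/

section ClosedLoop

variable {Δ : ℝ} {n m : ℕ} {f : Hist Δ n → Vec n}
  {g : Hist Δ n → Vec m →L[ℝ] Vec n} {U : Set (Vec m)} {V₁ : Vec n → ℝ} {V₂ : Hist Δ n → ℝ}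
  {γ : ℝ → ℝ} {lam : ℝ}

/-- `V₁` has a minimum at the origin. -/
lemma IsSmoothlySeparable.fderiv_zero (h : IsSmoothlySeparable V₁ V₂) :
    fderiv ℝ V₁ 0 = 0 := by
  obtain ⟨α₁, α₂, h₁, h₂, hα⟩ := h.bounds
  have h0 : V₁ 0 = 0 := le_antisymm (by simpa [h₂.map_zero] using (hα 0).2) (h.nonneg₁ 0)
  exact IsLocalMin.fderiv_eq_zero (Eventually.of_forall fun x => h0 ▸ h.nonneg₁ x)

lemma continuous_closedLoop (hf : Continuous f) (hg : Continuous g) {u : Hist Δ n → Vec m}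
    (hu : Continuous u) : Continuous (closedLoop f g u) :=
  hf.add (hg.clm_apply hu)

variable [hΔ : Fact (0 < Δ)]

lemma lieG_apply (φ : Hist Δ n) (u : Vec m) : lieG g V₁ φ u = inner ℝ (lieGT g V₁ φ) u := by
  rw [lieGT, InnerProductSpace.toDual_symm_apply]

lemma IsSmoothlySeparable.continuous_lieGT (h : IsSmoothlySeparable V₁ V₂) (hg : Continuous g) :
    Continuous (lieGT g V₁) :=
  (InnerProductSpace.toDual ℝ (Vec m)).symm.continuous.comp
    (((h.contDiff.continuous_fderiv one_ne_zero).comp continuous_now).clm_comp hg)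

lemma IsSmoothlySeparable.lieGT_zero (h : IsSmoothlySeparable V₁ V₂) :
    lieGT g V₁ (0 : Hist Δ n) = 0 := by
  have : now (0 : Hist Δ n) = 0 := rfl
  rw [lieGT, lieG, this, h.fderiv_zero, ContinuousLinearMap.zero_comp, map_zero]

lemma dini_zero (V₂ : Hist Δ n → ℝ) : dini V₂ 0 = 0 := by
  have hseg : ∀ v, seg Δ (IccExtend (by have := hΔ.out; linarith : -Δ ≤ (0 : ℝ))
      (0 : Hist Δ n)) v = seg Δ (IccExtend (by have := hΔ.out; linarith : -Δ ≤ (0 : ℝ))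
      (0 : Hist Δ n)) 0 := fun v => seg_eq_seg fun θ => rfl
  rw [dini, diniAlong]
  simp only [hseg, sub_self, zero_div, EReal.coe_zero, limsup_const, EReal.toReal_zero]

lemma IsCLKF.sepFunctional_nonneg (hV : IsCLKF f g U V₁ V₂ γ) (φ : Hist Δ n) :
    0 ≤ sepFunctional V₁ V₂ φ :=
  add_nonneg (hV.separable.nonneg₁ _) (hV.separable.nonneg₂ _)

lemma IsCLKF.continuous_aFun (hV : IsCLKF f g U V₁ V₂ γ) (hf : Continuous f) :
    Continuous (aFun f V₁ V₂ γ) := by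
  have h1 : Continuous (lieF f V₁) :=
    ((hV.separable.contDiff.continuous_fderiv one_ne_zero).comp continuous_now).clm_apply hf
  have h2 : Continuous fun φ => γ (sepFunctional V₁ V₂ φ) :=
    hV.classK.continuousOn.comp_continuous hV.separable.continuous_sepFunctional
      hV.sepFunctional_nonneg
  exact (h1.add hV.iDifferentiable.continuous_dini).add h2

/-- Where the input has no influence on `V`, the drift alone makes `V` decrease. -/
lemma IsCLKF.aFun_neg (hV : IsCLKF f g U V₁ V₂ γ) {φ : Hist Δ n} (hφ : φ ≠ 0)
    (hq : lieGT g V₁ φ = 0) : aFun f V₁ V₂ γ φ < 0 := by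
  have h1 : ((lieF f V₁ φ + dini V₂ φ : ℝ) : EReal) ≤
      ⨅ u ∈ U, ((lieF f V₁ φ + dini V₂ φ + lieG g V₁ φ u : ℝ) : EReal) :=
    le_iInf₂ fun u _ => by rw [lieG_apply, hq, inner_zero_left, add_zero]
  have h2 := EReal.coe_lt_coe_iff.mp (h1.trans_lt (hV.decrease φ hφ))
  rw [aFun]
  linarith

theorem continuous_controller (hf : Continuous f) (hg : Continuous g)
    (hV : IsCLKF f g U V₁ V₂ γ) (hscp : KrasovskiiSCP f g V₁ V₂ γ) (hlam : 0 ≤ lam) :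
    Continuous (controller f g V₁ V₂ γ lam) := by
  have ha := hV.continuous_aFun hf
  have hq := hV.separable.continuous_lieGT hg
  rw [continuous_iff_continuousAt]
  intro φ
  by_cases hφ : φ = 0
  · subst hφ
    have h0 : controller f g V₁ V₂ γ lam 0 = 0 := if_pos rfl
    rw [ContinuousAt, h0, Metric.tendsto_nhds]
    intro ε hε
    obtain ⟨δ, hδ, hu⟩ := hscp (ε / 3) (by positivity)
    have hev : ∀ᶠ φ in 𝓝 (0 : Hist Δ n), √lam * ‖lieGT g V₁ φ‖ < ε / 3 := by
      have hc : Continuous fun φ => √lam * ‖lieGT g V₁ φ‖ := by fun_prop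
      refine hc.continuousAt.eventually_lt continuousAt_const ?_
      rw [hV.separable.lieGT_zero, norm_zero, mul_zero]
      positivity
    filter_upwards [hev, Metric.ball_mem_nhds _ hδ] with φ hφ1 hφ2
    rw [dist_zero_right]
    rw [mem_ball_zero_iff] at hφ2
    rw [controller]
    split_ifs with hφ
    · simpa using hε
    · obtain ⟨u, hu1, hu2⟩ := hu φ hφ fun θ => (φ.norm_coe_le_norm θ).trans_lt hφ2
      rw [lieG_apply] at hu2
      have hcs := (abs_le.mp (abs_real_inner_le_norm (lieGT g V₁ φ) u)).1
      have hmul := mul_le_mul_of_nonneg_left hu1.le (norm_nonneg (lieGT g V₁ φ))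
      have := norm_kappa_le (lam := lam) (p := aFun f V₁ V₂ γ φ) (q := lieGT g V₁ φ) hlam
        (by positivity : 0 ≤ ε / 3) (by rw [aFun]; linarith)
      linarith
  · have hk : ContinuousAt (fun ψ => kappa lam (aFun f V₁ V₂ γ ψ) (lieGT g V₁ ψ)) φ :=
      (continuousAt_kappa hlam (hV.aFun_neg hφ)).comp
        (f := fun ψ => (aFun f V₁ V₂ γ ψ, lieGT g V₁ ψ))
        (ha.continuousAt.prodMk hq.continuousAt)
    refine hk.congr ?_
    filter_upwards [isOpen_ne.mem_nhds hφ] with ψ hψ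
    rw [controller, if_neg hψ]

/-- Sontag's feedback makes `V` decrease at the rate `γ` along the closed loop. -/
lemma IsCLKF.decay_closedLoop (hV : IsCLKF f g U V₁ V₂ γ) (hf0 : f 0 = 0) (φ : Hist Δ n) :
    fderiv ℝ V₁ (now φ) (closedLoop f g (controller f g V₁ V₂ γ lam) φ) + dini V₂ φ
      ≤ -γ (sepFunctional V₁ V₂ φ) := by
  by_cases hφ : φ = 0
  · subst hφ
    obtain ⟨α₁, α₂, h₁, h₂, hα⟩ := hV.bounds
    have hV0 : sepFunctional V₁ V₂ (0 : Hist Δ n) = 0 :=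
      le_antisymm (by simpa [h₂.map_zero] using (hα 0).2) (hV.sepFunctional_nonneg 0)
    have h0 : controller f g V₁ V₂ γ lam 0 = 0 := if_pos rfl
    rw [closedLoop, h0, hf0, map_zero, add_zero, map_zero, dini_zero, hV0, hV.classK.map_zero]
    simp
  · have hu : controller f g V₁ V₂ γ lam φ = kappa lam (aFun f V₁ V₂ γ φ) (lieGT g V₁ φ) :=
      if_neg hφ
    have hneg : aFun f V₁ V₂ γ φ + inner ℝ (lieGT g V₁ φ) (controller f g V₁ V₂ γ lam φ) ≤ 0 := by
      rw [hu]
      by_cases hq : lieGT g V₁ φ = 0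
      · have := hV.aFun_neg hφ hq
        rw [hq, inner_zero_left]
        linarith
      · rw [inner_kappa hq]
        exact neg_nonpos.mpr (Real.sqrt_nonneg _)
    have hsplit : fderiv ℝ V₁ (now φ) (closedLoop f g (controller f g V₁ V₂ γ lam) φ) =
        lieF f V₁ φ + inner ℝ (lieGT g V₁ φ) (controller f g V₁ V₂ γ lam φ) := by
      rw [closedLoop, map_add, ← lieG_apply]
      rfl
    rw [aFun] at hneg
    rw [hsplit]
    linarith

end ClosedLoop

end DelayControl

theorem mainTheorem2 {n m : ℕ} {Δ : ℝ} [Fact (0 < Δ)]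
    (f : Hist Δ n → Vec n) (g : Hist Δ n → Vec m →L[ℝ] Vec n) (U : Set (Vec m))
    (hf : LocallyLipschitz f) (hg : LocallyLipschitz g) (hf0 : f 0 = 0)
    (V₁ : Vec n → ℝ) (V₂ : Hist Δ n → ℝ) (γ : ℝ → ℝ)
    (hV : IsCLKF f g U V₁ V₂ γ) (hscp : KrasovskiiSCP f g V₁ V₂ γ)
    (lam : ℝ) (hlam : 0 < lam) :
    -- the feedback is continuous
    Continuous (controller f g V₁ V₂ γ lam) ∧
    -- the closed loop has solutions from every initial history
    (∀ ξ : Hist Δ n, ∃ (T : ℝ) (x : ℝ → Vec n), 0 < T ∧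
      IsSolutionOn (closedLoop f g (controller f g V₁ V₂ γ lam)) ξ T x) ∧
    -- the closed loop is globally asymptotically stable
    IsGAS (closedLoop f g (controller f g V₁ V₂ γ lam)) ∧
    -- if its right-hand side maps bounded sets to bounded sets, all solutions extend to `[-Δ, ∞)`
    (MapsBoundedToBounded (closedLoop f g (controller f g V₁ V₂ γ lam)) →
      ∀ (ξ : Hist Δ n) (T : ℝ) (x : ℝ → Vec n), 0 < T →
        IsSolutionOn (closedLoop f g (controller f g V₁ V₂ γ lam)) ξ T x →
        ∃ z : ℝ → Vec n, IsGlobalSolution (closedLoop f g (controller f g V₁ V₂ γ lam)) ξ z ∧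
          ∀ t ∈ Ico (-Δ) T, z t = x t) := by
  have hu := continuous_controller hf.continuous hg.continuous hV hscp hlam.le
  have hF := continuous_closedLoop hf.continuous hg.continuous hu
  have hgas : IsGAS (closedLoop f g (controller f g V₁ V₂ γ lam)) :=
    isGAS_of_decay hV.separable hV.iDifferentiable hV.bounds hV.classK (hV.decay_closedLoop hf0)
  exact ⟨hu, exists_isSolutionOn hF, hgas, hgas.exists_isGlobalSolution hF⟩
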